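/- **Setting.** A *stochastic graph* $G=(U,V,E)$ consists of finite sets $U$ (offline vertices) and $V$ (online vertices), $E=U\times V$, real edge weights $(w_e)_{e\in E}$, edge probabilities $p_e\in[0,1]$, and for each $v\in V$ a probing constraint $\mathcal C_v$: a set of strings of distinct edges at $v$ which contains the empty string and is downward-closed (closed under taking substrings and permutations). Each edge $e$ is active independently with probability $p_e$; its state is initially hidden and is revealed by probing $e$. At each $v$ the string of edges probed, in the order in which they are probed, must lie in $\mathcal C_v$. If a probed edge is active, the algorithm must irrevocably decide, before its next probe, whether to add it to its matching (probe-commit model). An *offline probing algorithm* knows $G$ (but not the edge states) and may adaptively, and with randomization, probe the edges of $E$ in any order; $\mathrm{OPT}(G)$ (the offline adaptive benchmark) is the optimal expected weight of the matching returned by such an algorithm. A *known i.d. input* $(H_{\rm typ},(\mathcal D_i)_{i=1}^n)$ consists of a type graph $H_{\rm typ}=(U,B,U\times B)$, which is a stochastic graph with a finite set $B$ of type nodes in place of the online vertices, and of distributions $\mathcal D_1,\dots,\mathcal D_n$ on $B$. The random graph $G$ has online vertices $v_1,\dots,v_n$, where $v_i$ has a type drawn independently from $\mathcal D_i$ and inherits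 the weights, probabilities and probing constraint of that type; the edge states of distinct $v_i$ are independent given the types. The benchmark is $\mathrm{OPT}(H_{\rm typ},(\mathcal D_i)_i):=\mathbb E[\mathrm{OPT}(G)]$. An *online probing algorithm* knows the input. In the adversarial order model an oblivious adversary fixes a permutation $\pi$ of $[n]$, unknown to the algorithm, which depends only on the input (not on the types, the edge states or the algorithm's random bits), and $v_{\pi(1)},\dots,v_{\pi(n)}$ arrive in this order. When $v_{\pi(t)}$ arrives, the algorithm learns its index $\pi(t)$ and its type, and may adaptively, and with randomization, probe edges at $v_{\pi(t)}$ before the next arrival, in the probe-commit model above. It is *$\alpha$-competitive* if for every known i.d. input and every $\pi$ the matching $\mathcal M$ that it returns satisfies $\mathbb E[w(\mathcal M)]\ge\alpha\cdot\mathrm{OPT}(H_{\rm typ},(\mathcal D_i)_i)$, the expectation being over the types, the edge states and the algorithm's randomness. **Statement.** In the adversarial order model there exists a $\tfrac12$-competitive online probing algorithm for known i.d. instances. The ratio $\tfrac12$ is optimal: for every $\alpha>\tfrac12$ there are a known i.d. input and an arrival order $\pi$ such that every online probing algorithm, even one designed for this input and this order, has $\mathbb E[w(\mathcal M)]<\alpha\cdot\mathrm{OPT}(H_{\rm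 typ},(\mathcal D_i)_i)$ when the online vertices arrive in the order $\pi$; in particular no online probing algorithm is $\alpha$-competitive. -/

import Mathlib

/-!
# Online stochastic matching with known i.d. instances (probe-commit model)

Edges of the complete bipartite graph on `U × V` are pairs `(u, v)`; absent edges have probability `0`.
A string of distinct edges at `v` is recorded as the duplicate-free list of its endpoints in `U`.
-/

universe u v

/-- A (finite, bipartite) stochastic graph with offline vertices `U`, online vertices `V`, edge weights,
edge probabilities and a downward-closed probing constraint for every online vertex. The same structure
serves as a type graph, `V` then being the set of type nodes. -/
structure StochasticGraph (U : Type u) (V : Type v) where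
  weight : U → V → ℝ
  prob : U → V → ℝ
  prob_nonneg : ∀ x y, 0 ≤ prob x y
  prob_le_one : ∀ x y, prob x y ≤ 1
  /-- the strings of edges at an online vertex which may be probed, in this order -/
  probing : V → Set (List U)
  probing_nodup : ∀ y, ∀ l ∈ probing y, l.Nodup
  probing_nil : ∀ y, [] ∈ probing y
  /-- closed under substrings -/
  probing_infix : ∀ y, ∀ l ∈ probing y, ∀ l', l' <:+: l → l' ∈ probing y
  /-- closed under permutations -/
  probing_perm : ∀ y, ∀ l ∈ probing y, ∀ l', l'.Perm l → l' ∈ probing y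

namespace StochasticGraph

/-- The probability that the edge states are `st`; the edges are active independently. -/
noncomputable def stateProb {U : Type u} {V : Type v} [Fintype U] [Fintype V]
    (G : StochasticGraph U V) (st : U → V → Bool) : ℝ :=
  ∏ x, ∏ y, if st x y then G.prob x y else 1 - G.prob x y

/-- The weight of a set of edges. -/
noncomputable def setWeight {U : Type u} {V : Type v} (G : StochasticGraph U V)
    (M : Finset (U × V)) : ℝ :=
  ∑ e ∈ M, G.weight e.1 e.2

open Classical in
/-- The expected weight, over the edge states, of the set of edges `f st` computed from them. -/
noncomputable def expectedWeight {U : Type u} {V : Type v} [Fintype U] [Fintype V]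
    (G : StochasticGraph U V) (f : (U → V → Bool) → Finset (U × V)) : ℝ :=
  ∑ st : U → V → Bool, G.stateProb st * G.setWeight (f st)

end StochasticGraph

/-- No edge of `M` meets the endpoints of the edge `(x, y)`. -/
def EdgeFree {U : Type u} {V : Type v} (M : Finset (U × V)) (x : U) (y : V) : Prop :=
  ∀ e ∈ M, e.1 ≠ x ∧ e.2 ≠ y

/-- The expectation of `f` when its argument is drawn from `μ`. -/
noncomputable def seedAverage {Ω : Type*} (μ : PMF Ω) (f : Ω → ℝ) : ℝ :=
  ∑' ω, (μ ω).toReal * f ω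

/-! ### Offline probing algorithms and the adaptive benchmark -/

/-- The record of one probe of an offline probing algorithm. -/
structure OfflineEvent (U : Type u) (V : Type v) where
  offline : U
  online : V
  active : Bool
  matched : Bool

/-- A deterministic offline probing algorithm. Its decisions depend on the probes made so far and
their outcomes. -/
structure OfflinePolicy (U : Type u) (V : Type v) where
  /-- the next edge to probe; `none` means stop -/
  probe : List (OfflineEvent U V) → Option (U × V)
  /-- if the edge just probed is active, whether to include it in the matching -/
  commit : List (OfflineEvent U V) → U × V → Bool

/-- The history and the current matching of an offline probing algorithm. -/
structure OfflineState (U : Type u) (V : Type v) where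
  history : List (OfflineEvent U V)
  matching : Finset (U × V)

open Classical in
/-- The string of edges at `y` probed so far. -/
noncomputable def OfflineState.probed {U : Type u} {V : Type v} (σ : OfflineState U V) (y : V) :
    List U :=
  (σ.history.filter (fun ev => decide (ev.online = y))).map OfflineEvent.offline

open Classical in
/-- Perform at most `k` further probes on a graph with edge states `st`. A probe which would violate the
probing constraint ends the execution, and a probed edge can be included only if it is active and both its
endpoints are unmatched. The decision is final and precedes the next probe. -/
noncomputable def OfflinePolicy.exec {U : Type u} {V : Type v} (P : OfflinePolicy U V)
    (G : StochasticGraph U V) (st : U → V → Bool) : ℕ → OfflineState U V → OfflineState U V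
  | 0, σ => σ
  | k + 1, σ =>
    match P.probe σ.history with
    | none => σ
    | some (x, y) =>
      if σ.probed y ++ [x] ∈ G.probing y then
        let acc : Bool := st x y && decide (EdgeFree σ.matching x y) && P.commit σ.history (x, y)
        P.exec G st k
          ⟨σ.history ++ [⟨x, y, st x y, acc⟩], if acc then insert (x, y) σ.matching else σ.matching⟩
      else σ

/-- The matching returned on a graph with edge states `st`. As no edge is probed twice,
`|U| * |V|` steps always suffice. -/
noncomputable def OfflinePolicy.run {U : Type u} {V : Type v} [Fintype U] [Fintype V]
    (P : OfflinePolicy U V) (G : StochasticGraph U V) (st : U → V → Bool) : Finset (U × V) :=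
  (P.exec G st (Fintype.card U * Fintype.card V) ⟨[], ∅⟩).matching

/-- The expected weight obtained by a randomized offline probing algorithm, which is a random choice,
independent of the edge states, of a deterministic one. -/
noncomputable def StochasticGraph.offlineValue {U : Type u} {V : Type v} [Fintype U] [Fintype V]
    (G : StochasticGraph U V) (A : PMF (OfflinePolicy U V)) : ℝ :=
  seedAverage A fun P => G.expectedWeight (P.run G)

/-- The offline adaptive benchmark `OPT(G)`. -/
noncomputable def StochasticGraph.opt {U : Type u} {V : Type v} [Fintype U] [Fintype V]
    (G : StochasticGraph U V) : ℝ :=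
  ⨆ A : PMF (OfflinePolicy U V), G.offlineValue A

/-! ### Known i.d. inputs -/

/-- A known i.d. input: a type graph on `U` and `B`, and distributions of the types of the `n` online
vertices. -/
structure KnownIDInput (U : Type u) (B : Type v) (n : ℕ) where
  typeGraph : StochasticGraph U B
  dist : Fin n → PMF B

namespace KnownIDInput

/-- The stochastic graph on `n` online vertices in which online vertex `i` has type `b i`. -/
def draw {U : Type u} {B : Type v} {n : ℕ} (I : KnownIDInput U B n) (b : Fin n → B) :
    StochasticGraph U (Fin n) where
  weight x i := I.typeGraph.weight x (b i)
  prob x i := I.typeGraph.prob x (b i)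
  prob_nonneg x i := I.typeGraph.prob_nonneg x (b i)
  prob_le_one x i := I.typeGraph.prob_le_one x (b i)
  probing i := I.typeGraph.probing (b i)
  probing_nodup i := I.typeGraph.probing_nodup (b i)
  probing_nil i := I.typeGraph.probing_nil (b i)
  probing_infix i := I.typeGraph.probing_infix (b i)
  probing_perm i := I.typeGraph.probing_perm (b i)

/-- The probability that the types are `b`; they are drawn independently. -/
noncomputable def typeProb {U : Type u} {B : Type v} {n : ℕ} (I : KnownIDInput U B n)
    (b : Fin n → B) : ℝ :=
  ∏ i, (I.dist i (b i)).toReal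

open Classical in
/-- The benchmark `E[OPT(G)]` over the random graph `G` drawn from the input. -/
noncomputable def opt {U : Type u} {B : Type v} [Fintype U] [Fintype B] {n : ℕ}
    (I : KnownIDInput U B n) : ℝ :=
  ∑ b : Fin n → B, I.typeProb b * (I.draw b).opt

end KnownIDInput

/-! ### Online probing algorithms -/

/-- What an online probing algorithm observes: the arrival of the online vertex with index `i` (that is,
drawn from the `i`-th distribution) and type `b`, or the outcome of a probe, at the current online vertex,
of the edge to an offline vertex. -/
inductive OnlineEvent (U : Type u) (B : Type v) (n : ℕ) where
  | arrive (i : Fin n) (b : B)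
  | probe (x : U) (active matched : Bool)

/-- A deterministic online probing algorithm for a fixed known i.d. input. Its decisions depend on
everything it has observed so far, the last arrival being the current online vertex. -/
structure OnlinePolicy (U : Type u) (B : Type v) (n : ℕ) where
  /-- the endpoint in `U` of the next edge to probe at the current online vertex;
  `none` means that the algorithm is done with this vertex -/
  probe : List (OnlineEvent U B n) → Option U
  /-- if the edge just probed is active, whether to include it in the matching -/
  commit : List (OnlineEvent U B n) → U → Bool

/-- The history and the current matching of an online probing algorithm. -/
structure OnlineState (U : Type u) (B : Type v) (n : ℕ) where
  history : List (OnlineEvent U B n)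
  matching : Finset (U × Fin n)

open Classical in
/-- Perform at most `k` further probes at the current online vertex `i`, with probing constraint `C` and
edge states `s`, the string of edges probed there so far being `l`. A probe which would violate the
constraint ends the processing of `i`; a probed edge can be included only if it is active and both its
endpoints are unmatched. The decision is final and precedes the next probe. -/
noncomputable def OnlinePolicy.process {U : Type u} {B : Type v} {n : ℕ} (P : OnlinePolicy U B n)
    (i : Fin n) (C : Set (List U)) (s : U → Bool) :
    ℕ → List U → OnlineState U B n → OnlineState U B n
  | 0, _, σ => σ
  | k + 1, l, σ =>
    match P.probe σ.history with
    | none => σ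
    | some x =>
      if l ++ [x] ∈ C then
        let acc : Bool := s x && decide (EdgeFree σ.matching x i) && P.commit σ.history x
        P.process i C s k (l ++ [x])
          ⟨σ.history ++ [.probe x (s x) acc], if acc then insert (x, i) σ.matching else σ.matching⟩
      else σ

/-- The matching returned when the types are `b`, the edge states are `st` and the online vertices arrive
in the order `π 0, …, π (n - 1)`. At most `|U|` edges can be probed at an online vertex. -/
noncomputable def OnlinePolicy.run {U : Type u} {B : Type v} [Fintype U] {n : ℕ}
    (P : OnlinePolicy U B n) (I : KnownIDInput U B n) (π : Equiv.Perm (Fin n)) (b : Fin n → B)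
    (st : U → Fin n → Bool) : Finset (U × Fin n) :=
  ((List.ofFn π).foldl
    (fun σ i => P.process i (I.typeGraph.probing (b i)) (fun x => st x i) (Fintype.card U) []
      ⟨σ.history ++ [.arrive i (b i)], σ.matching⟩)
    (⟨[], ∅⟩ : OnlineState U B n)).matching

open Classical in
/-- The expected weight of the matching returned, under arrival order `π`, by a randomized online probing
algorithm, over its random choice, the types and the edge states, all independent. -/
noncomputable def KnownIDInput.onlineValue {U : Type u} {B : Type v} [Fintype U] [Fintype B] {n : ℕ}
    (I : KnownIDInput U B n) (A : PMF (OnlinePolicy U B n)) (π : Equiv.Perm (Fin n)) : ℝ :=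
  seedAverage A fun P =>
    ∑ b : Fin n → B, I.typeProb b * (I.draw b).expectedWeight (P.run I π b)

/-- A (randomized) online probing algorithm for known i.d. instances: it is given the input, but not the
arrival order. -/
def OnlineProbingAlgorithm : Type (max (u + 1) (v + 1)) :=
  ∀ (U : Type u) (B : Type v) [Fintype U] [Fintype B] (n : ℕ),
    KnownIDInput U B n → PMF (OnlinePolicy U B n)

/-- `A` is `α`-competitive in the adversarial order model: on every input and for every arrival order
chosen by an oblivious adversary, it obtains at least `α` times the benchmark in expectation. -/
def OnlineProbingAlgorithm.IsCompetitive (A : OnlineProbingAlgorithm.{u, v}) (α : ℝ) : Prop :=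
  ∀ (U : Type u) (B : Type v) [Fintype U] [Fintype B] (n : ℕ) (I : KnownIDInput U B n)
    (π : Equiv.Perm (Fin n)), α * I.opt ≤ I.onlineValue (A U B n I) π

/-! Lower bound: give each offline vertex `x` a fixed price `p x`, half of the expected (positive
part of the) weight that an optimal offline algorithm collects at `x`, so that `I.opt ≤ 2 * ∑ x, p
x`. Each arriving vertex is probed optimally for the reward `max (w - p x) 0` on unsold `x`, by
dynamic programming on the string probed so far (`bestValue`).

Let `a i x` be the expected gain over the price that the benchmark makes on the edge `(x, i)`. Once
everything random outside `i` is fixed, the benchmark acts at `i` as a probing strategy for that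
vertex alone, so its reward there is at most the dynamic programming value
(`OfflinePolicy.rewardAt_exec_le`). Averaging, arrival `i` gains at least the sum of `a i x` over
unsold `x`, whatever the sold set (`sum_benchmarkGain_le`).

The analysis follows the potential "weight collected plus `c x` summed over unsold `x`". Here `c` is
`unsoldBound`, a number depending only on the vertices still to arrive, with `c ≤ p`. A sale adds
`w` and loses `c x ≤ p x`, so it nets at least the gain over the price; this gain pays for the
decrease of `c` to its next value. Hence the potential does not decrease in expectation
(`le_prodExp_arrivals`). It ends as the collected weight, and starts at `∑ x, p x` or more, because
`∑ i, a i x ≥ 2 * p x - p x`. No independence between sales is needed, and the arrival order plays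
no role.

Upper bound: one offline vertex, a sure edge of weight `1`, then an edge of weight `1 / ε` active
with probability `ε`. Online nothing beats `1`; offline, probing the risky edge first yields `2 -
ε`. -/

/-! ### Expectations over finite product spaces -/

/-- The expectation of `f` when the coordinates are independent, coordinate `i` having the law `m i`. -/
noncomputable def prodExp {ι α : Type*} [Fintype ι] [DecidableEq ι] [Fintype α] (m : ι → α → ℝ)
    (f : (ι → α) → ℝ) : ℝ :=
  ∑ η : ι → α, (∏ i, m i (η i)) * f η

section prodExp

variable {ι α : Type*} [Fintype ι] [DecidableEq ι] [Fintype α] {m : ι → α → ℝ}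

theorem prodExp_mono (hm : ∀ i a, 0 ≤ m i a) {f g : (ι → α) → ℝ} (h : ∀ η, f η ≤ g η) :
    prodExp m f ≤ prodExp m g :=
  Finset.sum_le_sum fun η _ =>
    mul_le_mul_of_nonneg_left (h η) (Finset.prod_nonneg fun i _ => hm i _)

theorem prodExp_const (hm : ∀ i, ∑ a, m i a = 1) (c : ℝ) : prodExp m (fun _ => c) = c := by
  unfold prodExp
  rw [← Finset.sum_mul, ← Fintype.prod_sum]
  simp [hm]

theorem prodExp_add (f g : (ι → α) → ℝ) :
    prodExp m (fun η => f η + g η) = prodExp m f + prodExp m g := by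
  simp [prodExp, mul_add, Finset.sum_add_distrib]

theorem prodExp_const_mul (c : ℝ) (f : (ι → α) → ℝ) :
    prodExp m (fun η => c * f η) = c * prodExp m f := by
  simp [prodExp, Finset.mul_sum, mul_left_comm]

theorem prodExp_sum {κ : Type*} (s : Finset κ) (f : κ → (ι → α) → ℝ) :
    prodExp m (fun η => ∑ k ∈ s, f k η) = ∑ k ∈ s, prodExp m (f k) := by
  simp only [prodExp, Finset.mul_sum]
  exact Finset.sum_comm

theorem prodExp_nonneg (hm : ∀ i a, 0 ≤ m i a) {f : (ι → α) → ℝ} (h : ∀ η, 0 ≤ f η) :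
    0 ≤ prodExp m f :=
  Finset.sum_nonneg fun η _ => mul_nonneg (Finset.prod_nonneg fun i _ => hm i _) (h η)

/-- Drawing one coordinate again does not change the expectation. -/
theorem prodExp_resample (i : ι) (hm : ∑ a, m i a = 1) (f : (ι → α) → ℝ) :
    prodExp m f = ∑ a, m i a * prodExp m (fun η => f (Function.update η i a)) := by
  have key : ∀ (η : ι → α) (a : α),
      m i (η i) * ∏ j, m j (Function.update η i a j) = m i a * ∏ j, m j (η j) := by
    intro η a
    rw [← Finset.mul_prod_erase _ _ (Finset.mem_univ i),
      ← Finset.mul_prod_erase _ (fun j => m j (η j)) (Finset.mem_univ i), Function.update_self]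
    have : ∏ j ∈ Finset.univ.erase i, m j (Function.update η i a j)
        = ∏ j ∈ Finset.univ.erase i, m j (η j) :=
      Finset.prod_congr rfl fun j hj => by rw [Function.update_of_ne (Finset.ne_of_mem_erase hj)]
    rw [this]; ring
  -- Exchanging coordinate `i` with an independent fresh copy is an involution that preserves the
  -- product weight.
  let e : (ι → α) × α ≃ (ι → α) × α :=
    { toFun := fun q => (Function.update q.1 i q.2, q.1 i)
      invFun := fun q => (Function.update q.1 i q.2, q.1 i)
      left_inv := fun q => by simp
      right_inv := fun q => by simp }
  calc prodExp m f = ∑ q : (ι → α) × α, (m i q.2 * ∏ j, m j (q.1 j)) * f q.1 := by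
        rw [Fintype.sum_prod_type]
        refine Finset.sum_congr rfl fun η _ => ?_
        simp only [← Finset.sum_mul, hm, one_mul]
    _ = ∑ q : (ι → α) × α,
          (m i (q.1 i) * ∏ j, m j (Function.update q.1 i q.2 j)) * f (Function.update q.1 i q.2) :=
        (Equiv.sum_comp e fun q => (m i q.2 * ∏ j, m j (q.1 j)) * f q.1).symm
    _ = _ := by
        simp only [key]
        rw [Fintype.sum_prod_type_right]
        refine Finset.sum_congr rfl fun a _ => ?_
        simp only [prodExp, Finset.mul_sum, mul_assoc]

end prodExp

/-- The law of a Boolean which is true with probability `p x`. -/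
noncomputable def bern {U : Type*} (p : U → ℝ) (x : U) (t : Bool) : ℝ := if t then p x else 1 - p x

theorem bern_nonneg {U : Type*} {p : U → ℝ} (h0 : ∀ x, 0 ≤ p x) (h1 : ∀ x, p x ≤ 1) (x : U)
    (t : Bool) : 0 ≤ bern p x t := by
  unfold bern; split
  · exact h0 x
  · linarith [h1 x]

theorem sum_bern {U : Type*} (p : U → ℝ) (x : U) : ∑ t, bern p x t = 1 := by
  simp [bern]

/-- Conditioning on one coordinate. -/
theorem prodExp_bern_ite {U : Type*} [Fintype U] [DecidableEq U] (p : U → ℝ) (x : U)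
    (f g : (U → Bool) → ℝ) (hf : ∀ s t, f (Function.update s x t) = f s)
    (hg : ∀ s t, g (Function.update s x t) = g s) :
    prodExp (bern p) (fun s => if s x then f s else g s)
      = p x * prodExp (bern p) f + (1 - p x) * prodExp (bern p) g := by
  rw [prodExp_resample x (sum_bern p x)]
  simp [bern, hf, hg]

/-! ### The optimal probing of a single online vertex -/

section bestValue

open Classical in
/-- The value of a first move of a probing strategy at an online vertex, if `v` is the value of continuing
afterwards: stopping, or probing an edge and keeping it when active and worthwhile. -/
noncomputable def moveValue {U : Type*} (p r : U → ℝ) (C : Set (List U)) (v : List U → ℝ)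
    (l : List U) : Option U → ℝ
  | none => 0
  | some x =>
    if l ++ [x] ∈ C then p x * max (r x) (v (l ++ [x])) + (1 - p x) * v (l ++ [x]) else 0

variable {U : Type*} [Fintype U]

/-- The optimal expected reward of at most `k` further probes at an online vertex with constraint `C`
when the string `l` has been probed, `r x` being the reward for matching to `x`. -/
noncomputable def bestValue (p r : U → ℝ) (C : Set (List U)) : ℕ → List U → ℝ
  | 0, _ => 0
  | k + 1, l => Finset.univ.sup' Finset.univ_nonempty (moveValue p r C (bestValue p r C k) l)

theorem exists_bestMove (p r : U → ℝ) (C : Set (List U)) (k : ℕ) (l : List U) :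
    ∃ o, bestValue p r C (k + 1) l = moveValue p r C (bestValue p r C k) l o := by
  obtain ⟨o, -, ho⟩ := Finset.exists_mem_eq_sup' Finset.univ_nonempty
    (moveValue p r C (bestValue p r C k) l)
  exact ⟨o, ho⟩

/-- An optimal next probe. -/
noncomputable def bestMove (p r : U → ℝ) (C : Set (List U)) : ℕ → List U → Option U
  | 0, _ => none
  | k + 1, l => (exists_bestMove p r C k l).choose

theorem bestValue_succ (p r : U → ℝ) (C : Set (List U)) (k : ℕ) (l : List U) :
    bestValue p r C (k + 1) l
      = moveValue p r C (bestValue p r C k) l (bestMove p r C (k + 1) l) :=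
  (exists_bestMove p r C k l).choose_spec

theorem moveValue_le_bestValue (p r : U → ℝ) (C : Set (List U)) (k : ℕ) (l : List U)
    (o : Option U) : moveValue p r C (bestValue p r C k) l o ≤ bestValue p r C (k + 1) l :=
  Finset.le_sup' (moveValue p r C (bestValue p r C k) l) (Finset.mem_univ o)

theorem bestValue_nonneg (p r : U → ℝ) (C : Set (List U)) (k : ℕ) (l : List U) :
    0 ≤ bestValue p r C k l := by
  cases k with
  | zero => exact le_rfl
  | succ k => exact moveValue_le_bestValue p r C k l none

end bestValue

/-! ### Offline probing algorithms restricted to one online vertex -/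

section offline

open scoped Classical

variable {U : Type u} {V : Type v}

theorem OfflineState.probed_append (h : List (OfflineEvent U V)) (M M' : Finset (U × V))
    (ev : OfflineEvent U V) (y : V) :
    (⟨h ++ [ev], M⟩ : OfflineState U V).probed y
      = (⟨h, M'⟩ : OfflineState U V).probed y ++ (if ev.online = y then [ev.offline] else []) := by
  by_cases hy : ev.online = y <;> simp [OfflineState.probed, hy]

/-- Every offline vertex, and every online vertex, is in at most one of the edges. -/
def IsEdgeMatching (M : Finset (U × V)) : Prop :=
  ∀ e ∈ M, ∀ e' ∈ M, e.1 = e'.1 ∨ e.2 = e'.2 → e = e'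

theorem IsEdgeMatching.insert {M : Finset (U × V)} (hM : IsEdgeMatching M) {x : U} {y : V}
    (h : EdgeFree M x y) : IsEdgeMatching (insert (x, y) M) := by
  intro e he e' he' hee
  rw [Finset.mem_insert] at he he'
  rcases he with rfl | he <;> rcases he' with rfl | he'
  · rfl
  · have := h e' he'
    rcases hee with hee | hee
    · exact absurd hee.symm this.1
    · exact absurd hee.symm this.2
  · have := h e he
    rcases hee with hee | hee
    · exact absurd hee this.1
    · exact absurd hee this.2
  · exact hM e he e' he' hee

theorem OfflinePolicy.isEdgeMatching_exec (P : OfflinePolicy U V) (G : StochasticGraph U V)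
    (st : U → V → Bool) (k : ℕ) (σ : OfflineState U V) (hσ : IsEdgeMatching σ.matching) :
    IsEdgeMatching (P.exec G st k σ).matching := by
  induction k generalizing σ with
  | zero => exact hσ
  | succ k ih =>
    unfold OfflinePolicy.exec
    split
    · exact hσ
    · split
      · apply ih
        dsimp only
        split
        · rename_i hacc
          simp only [Bool.and_eq_true, decide_eq_true_eq] at hacc
          exact hσ.insert hacc.1.2
        · exact hσ
      · exact hσ

/-- Once `y` is matched, its edge stays. -/
theorem OfflinePolicy.mem_exec_of_matched (P : OfflinePolicy U V) (G : StochasticGraph U V)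
    (st : U → V → Bool) (k : ℕ) (σ : OfflineState U V) (y : V) (hy : ∃ x, (x, y) ∈ σ.matching)
    (x : U) : (x, y) ∈ (P.exec G st k σ).matching ↔ (x, y) ∈ σ.matching := by
  induction k generalizing σ with
  | zero => exact Iff.rfl
  | succ k ih =>
    unfold OfflinePolicy.exec
    split
    · exact Iff.rfl
    · rename_i x' y' _
      split
      · obtain ⟨x₀, hx₀⟩ := hy
        rw [ih]
        · dsimp only
          split
          · rename_i hacc
            simp only [Bool.and_eq_true, decide_eq_true_eq] at hacc
            have : y ≠ y' := (hacc.1.2 _ hx₀).2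
            simp [this]
          · exact Iff.rfl
        · refine ⟨x₀, ?_⟩
          dsimp only
          split
          · exact Finset.mem_insert_of_mem hx₀
          · exact hx₀
      · exact Iff.rfl

theorem StochasticGraph.notMem_of_append {G : StochasticGraph U V} {y : V} {l : List U} {x : U}
    (h : l ++ [x] ∈ G.probing y) : x ∉ l := by
  have := G.probing_nodup y _ h
  rw [List.nodup_append] at this
  intro hx
  exact this.2.2 x hx x (by simp) rfl

/-- The states of edges already probed are irrelevant for the rest of the execution. -/
theorem OfflinePolicy.exec_congr (P : OfflinePolicy U V) (G : StochasticGraph U V)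
    (st st' : U → V → Bool) (k : ℕ) (σ : OfflineState U V)
    (h : ∀ x y, x ∉ σ.probed y → st x y = st' x y) :
    P.exec G st k σ = P.exec G st' k σ := by
  induction k generalizing σ with
  | zero => rfl
  | succ k ih =>
    unfold OfflinePolicy.exec
    split
    · rfl
    · rename_i x y _
      split
      · rename_i hC
        rw [h x y (StochasticGraph.notMem_of_append hC)]
        apply ih
        intro x' y' hx'
        apply h
        rw [OfflineState.probed_append _ _ σ.matching] at hx'
        exact fun hx => hx' (List.mem_append_left _ hx)
      · rfl

/-- The reward which the matching `M` yields at the online vertex `y`. -/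
noncomputable def rewardAt [Fintype U] (r : U → ℝ) (y : V) (M : Finset (U × V)) : ℝ :=
  ∑ x, if (x, y) ∈ M then r x else 0

theorem rewardAt_eq_zero [Fintype U] (r : U → ℝ) {y : V} {M : Finset (U × V)}
    (h : ∀ x, (x, y) ∉ M) : rewardAt r y M = 0 := by
  simp [rewardAt, h]

/-- This is why `moveValue` may treat keeping an edge as the end of the game at `y`: later probes
cannot change the reward there. -/
theorem OfflinePolicy.rewardAt_exec_of_matched [Fintype U] (P : OfflinePolicy U V)
    (G : StochasticGraph U V) (st : U → V → Bool) (k : ℕ) (σ : OfflineState U V) (y : V)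
    (hy : ∃ x, (x, y) ∈ σ.matching) (r : U → ℝ) :
    rewardAt r y (P.exec G st k σ).matching = rewardAt r y σ.matching := by
  simp only [rewardAt, P.mem_exec_of_matched G st k σ y hy]

/-- The edge states `st`, those at `y` being replaced by `s`. -/
noncomputable def setColumn (st : U → V → Bool) (y : V) (s : U → Bool) : U → V → Bool :=
  fun x y' => if y' = y then s x else st x y'

/-- No edge is probed twice, so after the probe of `x` the continuation is independent of the state
of `x`; this licenses conditioning through `prodExp_bern_ite`. -/
theorem OfflinePolicy.exec_setColumn_update (P : OfflinePolicy U V) (G : StochasticGraph U V)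
    (st : U → V → Bool) (y : V) (k : ℕ) (σ : OfflineState U V) (x : U) (hx : x ∈ σ.probed y)
    (s : U → Bool) (t : Bool) :
    P.exec G (setColumn st y (Function.update s x t)) k σ = P.exec G (setColumn st y s) k σ := by
  apply P.exec_congr
  intro x' y' hx'
  unfold setColumn
  split
  · subst y'
    rw [Function.update_of_ne]
    rintro rfl
    exact hx' hx
  · rfl

/-- No offline algorithm has a larger expected reward at `y` than the best probing of `y` alone. -/
theorem OfflinePolicy.rewardAt_exec_le [Fintype U] (P : OfflinePolicy U V)
    (G : StochasticGraph U V) (st : U → V → Bool) (y : V) (r : U → ℝ) (K : ℕ) :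
    ∀ (σ : OfflineState U V) (k : ℕ), k + (σ.probed y).length = Fintype.card U →
      (∀ x, (x, y) ∉ σ.matching) →
      prodExp (bern fun x => G.prob x y)
          (fun s => rewardAt r y (P.exec G (setColumn st y s) K σ).matching)
        ≤ bestValue (fun x => G.prob x y) r (G.probing y) k (σ.probed y) := by
  have hsum := sum_bern fun x => G.prob x y
  induction K with
  | zero =>
    intro σ k _ hM
    simp only [OfflinePolicy.exec, rewardAt_eq_zero r hM, prodExp_const hsum]
    exact bestValue_nonneg _ _ _ _ _
  | succ K ih =>
    intro σ k hk hM
    have hidle : prodExp (bern fun x => G.prob x y) (fun _ => rewardAt r y σ.matching)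
        ≤ bestValue (fun x => G.prob x y) r (G.probing y) k (σ.probed y) := by
      rw [prodExp_const hsum, rewardAt_eq_zero r hM]
      exact bestValue_nonneg _ _ _ _ _
    rcases hP : P.probe σ.history with _ | ⟨x, y'⟩
    · simpa only [OfflinePolicy.exec, hP] using hidle
    by_cases hC : σ.probed y' ++ [x] ∈ G.probing y'
    swap
    · simpa only [OfflinePolicy.exec, hP, hC, if_false] using hidle
    simp only [OfflinePolicy.exec, hP, hC, if_true]
    by_cases hy : y' = y
    · subst hy
      -- Admissible strings have no repetition, so the budget `k` is still positive when another
      -- legal probe at `y` takes place.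
      have hlen : (σ.probed y').length + 1 ≤ Fintype.card U := by
        simpa using (G.probing_nodup y' _ hC).length_le_card
      obtain ⟨k, rfl⟩ : ∃ k', k = k' + 1 := ⟨k - 1, by omega⟩
      set l := σ.probed y' with hl
      let F : Bool → OfflineState U V := fun t =>
        let acc : Bool := t && decide (EdgeFree σ.matching x y') && P.commit σ.history (x, y')
        ⟨σ.history ++ [⟨x, y', t, acc⟩], if acc then insert (x, y') σ.matching else σ.matching⟩
      have hF : ∀ t, (F t).probed y' = l ++ [x] := by
        intro t
        rw [OfflineState.probed_append _ _ σ.matching]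
        simp [hl]
      let R : Bool → (U → Bool) → ℝ := fun t s =>
        rewardAt r y' (P.exec G (setColumn st y' s) K (F t)).matching
      have hR : ∀ t s t', R t (Function.update s x t') = R t s := by
        intro t s t'
        simp only [R]
        rw [P.exec_setColumn_update _ _ _ _ _ _ (by simp [hF])]
      have hV : ∀ t, (∀ x, (x, y') ∉ (F t).matching) → prodExp (bern fun x => G.prob x y') (R t)
          ≤ bestValue (fun x => G.prob x y') r (G.probing y') k (l ++ [x]) := by
        intro t ht
        have := ih (F t) k (by rw [hF]; simp; omega) ht
        rwa [hF] at this
      have h0 := hV false (by simpa [F] using hM)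
      -- If the active edge is kept, the reward is frozen at `r x`; otherwise `y` stays unmatched
      -- and the induction hypothesis applies.
      have h1 : prodExp (bern fun x => G.prob x y') (R true)
          ≤ max (r x) (bestValue (fun x => G.prob x y') r (G.probing y') k (l ++ [x])) := by
        by_cases hacc : (decide (EdgeFree σ.matching x y') && P.commit σ.history (x, y')) = true
        · have hm : (F true).matching = insert (x, y') σ.matching := by
            simp only [F, Bool.true_and, hacc, if_true]
          have : ∀ s, R true s = r x := by
            intro s
            simp only [R]
            rw [P.rewardAt_exec_of_matched _ _ _ _ _ ⟨x, by simp [hm]⟩, hm]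
            simp [rewardAt, hM]
          simp only [show R true = fun _ => r x from funext this, prodExp_const hsum]
          exact le_max_left _ _
        · refine (hV true ?_).trans (le_max_right _ _)
          have hm : (F true).matching = σ.matching := by
            simp only [F, Bool.true_and, hacc]
            simp
          rwa [hm]
      have hsplit : (fun s => rewardAt r y' (P.exec G (setColumn st y' s) K
            (F (setColumn st y' s x y'))).matching)
          = fun s => if s x then R true s else R false s := by
        funext s
        have : setColumn st y' s x y' = s x := by simp [setColumn]
        rw [this]
        cases s x <;> simp [R]
      change prodExp _ (fun s => rewardAt r y' (P.exec G (setColumn st y' s) K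
            (F (setColumn st y' s x y'))).matching) ≤ _
      rw [hsplit, prodExp_bern_ite _ _ _ _ (hR true) (hR false)]
      refine le_trans ?_ (moveValue_le_bestValue _ _ _ _ _ (some x))
      simp only [moveValue, hC, if_true]
      exact add_le_add (mul_le_mul_of_nonneg_left h1 (G.prob_nonneg _ _))
        (mul_le_mul_of_nonneg_left h0 (by linarith [G.prob_le_one x y']))
    -- A probe at another online vertex has an outcome fixed by `st` and leaves the string at `y`
    -- and the budget `k` unchanged.
    · have hcol : ∀ s, setColumn st y s x y' = st x y' := fun s => by simp [setColumn, hy]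
      simp only [hcol]
      set σ' : OfflineState U V := ⟨σ.history ++ [⟨x, y', st x y',
        st x y' && decide (EdgeFree σ.matching x y') && P.commit σ.history (x, y')⟩],
        if (st x y' && decide (EdgeFree σ.matching x y') && P.commit σ.history (x, y')) = true
          then insert (x, y') σ.matching else σ.matching⟩ with hσ'
      have hp : σ'.probed y = σ.probed y := by
        rw [hσ', OfflineState.probed_append _ _ σ.matching]
        simp [hy]
      have := ih σ' k (by rw [hp]; exact hk) (by
        intro x₁
        rw [hσ']
        dsimp only
        split
        · simp [hM, Ne.symm hy]
        · exact hM x₁)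
      rwa [hp] at this

end offline

/-! ### Optimal offline probing algorithms -/

/-- The bound `d` only serves to make the series summable; otherwise `tsum` would take its default
value `0`. -/
theorem seedAverage_le {Ω : Type*} (μ : PMF Ω) {f : Ω → ℝ} {c : ℝ} {d : ℝ} (h : ∀ ω, f ω ≤ c)
    (hd : ∀ ω, |f ω| ≤ d) : seedAverage μ f ≤ c := by
  have hs : Summable fun ω => (μ ω).toReal := ENNReal.summable_toReal μ.tsum_coe_ne_top
  have h1 : ∑' ω, (μ ω).toReal = 1 := by
    rw [← ENNReal.tsum_toReal_eq fun ω => μ.apply_ne_top ω, μ.tsum_coe, ENNReal.toReal_one]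
  have hf : Summable fun ω => (μ ω).toReal * f ω := by
    refine Summable.of_norm_bounded (hs.mul_right d) fun ω => ?_
    rw [norm_mul, Real.norm_eq_abs, Real.norm_eq_abs, abs_of_nonneg ENNReal.toReal_nonneg]
    exact mul_le_mul_of_nonneg_left (hd ω) ENNReal.toReal_nonneg
  calc seedAverage μ f ≤ ∑' ω, (μ ω).toReal * c :=
        hf.tsum_le_tsum (fun ω => mul_le_mul_of_nonneg_left (h ω) ENNReal.toReal_nonneg)
          (hs.mul_right c)
    _ = c := by rw [tsum_mul_right, h1, one_mul]

theorem seedAverage_pure {Ω : Type*} (ω : Ω) (f : Ω → ℝ) : seedAverage (PMF.pure ω) f = f ω := by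
  classical
  unfold seedAverage
  rw [tsum_eq_single ω]
  · simp
  · intro ω' h
    simp [PMF.pure_apply, h]

namespace StochasticGraph

variable {U : Type u} {V : Type v} [Fintype U] [Fintype V]

/-- There are infinitely many policies, but the value depends only on the induced map from edge
states to edge sets, and such maps are finite in number. Hence the supremum in `opt` is attained,
even by a deterministic policy. -/
theorem finite_range_expectedWeight (G : StochasticGraph U V) :
    (Set.range fun P : OfflinePolicy U V => G.expectedWeight (P.run G)).Finite := by
  have : (Set.range fun P : OfflinePolicy U V => G.expectedWeight (P.run G))
      ⊆ Set.range G.expectedWeight := by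
    rintro _ ⟨P, rfl⟩
    exact ⟨_, rfl⟩
  refine Set.Finite.subset ?_ this
  classical
  exact Set.finite_range _

theorem exists_optimal_policy (G : StochasticGraph U V) :
    ∃ P : OfflinePolicy U V,
      ∀ A : PMF (OfflinePolicy U V), G.offlineValue A ≤ G.expectedWeight (P.run G) := by
  have hfin := G.finite_range_expectedWeight
  have hne : (Set.range fun P : OfflinePolicy U V => G.expectedWeight (P.run G)).Nonempty :=
    ⟨_, ⟨⟨fun _ => none, fun _ _ => false⟩, rfl⟩⟩
  obtain ⟨_, ⟨P, rfl⟩, hP⟩ := hfin.exists_maximal hne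
  obtain ⟨d, hd⟩ := (hfin.image abs).bddAbove
  have hmax : ∀ Q : OfflinePolicy U V, G.expectedWeight (Q.run G) ≤ G.expectedWeight (P.run G) :=
    fun Q => (le_total _ _).elim id fun h => hP ⟨Q, rfl⟩ h
  exact ⟨P, fun A => seedAverage_le A hmax (d := d) fun Q => hd ⟨_, ⟨Q, rfl⟩, rfl⟩⟩

theorem expectedWeight_le_opt (G : StochasticGraph U V) (P : OfflinePolicy U V) :
    G.expectedWeight (P.run G) ≤ G.opt := by
  obtain ⟨Q, hQ⟩ := G.exists_optimal_policy
  refine le_ciSup_of_le ⟨_, Set.forall_mem_range.2 hQ⟩ (PMF.pure P) ?_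
  rw [offlineValue, seedAverage_pure]

/-- An optimal offline probing algorithm. -/
noncomputable def optPolicy (G : StochasticGraph U V) : OfflinePolicy U V :=
  G.exists_optimal_policy.choose

theorem opt_le_optPolicy (G : StochasticGraph U V) :
    G.opt ≤ G.expectedWeight (G.optPolicy.run G) := by
  have : Nonempty (PMF (OfflinePolicy U V)) :=
    ⟨PMF.pure ⟨fun _ => none, fun _ _ => false⟩⟩
  exact ciSup_le G.exists_optimal_policy.choose_spec

end StochasticGraph

/-! ### The joint law of the types and the edge states -/

namespace KnownIDInput

open scoped Classical

variable {U : Type u} {B : Type v} [Fintype U] {n : ℕ}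

/-- The joint probability of the type and the edge states of online vertex `i`. -/
noncomputable def law (I : KnownIDInput U B n) (i : Fin n) (a : B × (U → Bool)) : ℝ :=
  (I.dist i a.1).toReal * ∏ x, bern (fun x => I.typeGraph.prob x a.1) x (a.2 x)

theorem law_nonneg (I : KnownIDInput U B n) (i : Fin n) (a : B × (U → Bool)) : 0 ≤ I.law i a :=
  mul_nonneg ENNReal.toReal_nonneg (Finset.prod_nonneg fun x _ =>
    bern_nonneg (fun x => I.typeGraph.prob_nonneg x a.1) (fun x => I.typeGraph.prob_le_one x a.1) x _)

variable [Fintype B]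

theorem sum_toReal_pmf (μ : PMF B) : ∑ b, (μ b).toReal = 1 := by
  rw [← ENNReal.toReal_sum fun b _ => μ.apply_ne_top b, ← tsum_fintype (L := .unconditional B),
    μ.tsum_coe, ENNReal.toReal_one]

theorem sum_law_mul (I : KnownIDInput U B n) (i : Fin n) (g : B → (U → Bool) → ℝ) :
    ∑ a, I.law i a * g a.1 a.2
      = ∑ b, (I.dist i b).toReal * prodExp (bern fun x => I.typeGraph.prob x b) (g b) := by
  rw [Fintype.sum_prod_type]
  simp only [law, prodExp, Finset.mul_sum, mul_assoc]

theorem sum_law (I : KnownIDInput U B n) (i : Fin n) : ∑ a, I.law i a = 1 := by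
  have := I.sum_law_mul i fun _ _ => 1
  simpa only [mul_one, prodExp_const (sum_bern _), sum_toReal_pmf] using this

/-- Types and edge states are regrouped by online vertex, so that everything random about vertex `i`
becomes a single coordinate that can be resampled. -/
theorem sum_typeProb_mul (I : KnownIDInput U B n)
    (f : (Fin n → B) → (U → Fin n → Bool) → Finset (U × Fin n)) :
    ∑ b, I.typeProb b * (I.draw b).expectedWeight (f b)
      = prodExp I.law fun η => (I.draw fun i => (η i).1).setWeight
          (f (fun i => (η i).1) fun x i => (η i).2 x) := by
  have hE : ∀ b, (I.draw b).expectedWeight (f b)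
      = ∑ st : U → Fin n → Bool, (I.draw b).stateProb st * (I.draw b).setWeight (f b st) := by
    intro b
    unfold StochasticGraph.expectedWeight
    congr!
  simp only [hE, Finset.mul_sum]
  rw [← Fintype.sum_prod_type' (f := fun b st => I.typeProb b * ((I.draw b).stateProb st *
    (I.draw b).setWeight (f b st)))]
  let e : (Fin n → B × (U → Bool)) ≃ (Fin n → B) × (U → Fin n → Bool) :=
    { toFun := fun η => (fun i => (η i).1, fun x i => (η i).2 x)
      invFun := fun q i => (q.1 i, fun x => q.2 x i)
      left_inv := fun _ => rfl
      right_inv := fun _ => rfl }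
  rw [← Equiv.sum_comp e]
  refine Finset.sum_congr rfl fun η _ => ?_
  rw [← mul_assoc]
  congr 1
  simp only [typeProb, StochasticGraph.stateProb, law, Finset.prod_mul_distrib, e, Equiv.coe_fn_mk,
    draw, bern]
  rw [Finset.prod_comm]

end KnownIDInput

/-! ### The price policy -/

/-- What the price policy remembers of the history: the type of the current online vertex, the edges
probed there, whether it is matched, and the offline vertices matched so far. -/
structure OnlineView (U : Type u) (B : Type v) where
  current : Option B
  probed : List U
  matched : Bool
  sold : Set U

namespace OnlineView

variable {U : Type u} {B : Type v} {n : ℕ}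

/-- The update of the view by an event. -/
def step (w : OnlineView U B) : OnlineEvent U B n → OnlineView U B
  | .arrive _ b => ⟨some b, [], false, w.sold⟩
  | .probe x _ m => ⟨w.current, w.probed ++ [x], w.matched || m, {y | y ∈ w.sold ∨ (m = true ∧ y = x)}⟩

/-- The view of a history. -/
def ofHistory (h : List (OnlineEvent U B n)) : OnlineView U B := h.foldl step ⟨none, [], false, ∅⟩

theorem ofHistory_append (h : List (OnlineEvent U B n)) (ev : OnlineEvent U B n) :
    ofHistory (h ++ [ev]) = (ofHistory h).step ev := by
  simp [ofHistory]

end OnlineView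

namespace KnownIDInput

open scoped Classical

variable {U : Type u} {B : Type v} [Fintype U] {n : ℕ}

/-- The gain over the price of selling `x` to an online vertex of type `b`. -/
noncomputable def saleReward (I : KnownIDInput U B n) (price : U → ℝ) (sold : Set U) (b : B)
    (x : U) : ℝ :=
  if x ∈ sold then 0 else max (I.typeGraph.weight x b - price x) 0

/-- The optimal expected gain over the prices of `k` further probes at an online vertex of type `b`. -/
noncomputable def saleValue (I : KnownIDInput U B n) (price : U → ℝ) (sold : Set U) (b : B) :
    ℕ → List U → ℝ :=
  bestValue (fun x => I.typeGraph.prob x b) (I.saleReward price sold b) (I.typeGraph.probing b)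

/-- The online probing algorithm which treats every online vertex optimally with respect to fixed prices
of the offline vertices. -/
noncomputable def pricePolicy (I : KnownIDInput U B n) (price : U → ℝ) : OnlinePolicy U B n where
  probe h :=
    let w := OnlineView.ofHistory h
    match w.current with
    | none => none
    | some b =>
      if w.matched then none
      else bestMove (fun x => I.typeGraph.prob x b) (I.saleReward price w.sold b)
        (I.typeGraph.probing b) (Fintype.card U - w.probed.length) w.probed
  commit h x :=
    let w := OnlineView.ofHistory h
    match w.current with
    | none => false
    | some b => decide (I.saleValue price w.sold b (Fintype.card U - w.probed.length - 1)
        (w.probed ++ [x]) < I.saleReward price w.sold b x)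

end KnownIDInput

/-! ### Invariants of online executions -/

namespace OnlinePolicy

open scoped Classical

variable {U : Type u} {B : Type v} {n : ℕ}

theorem process_congr (P : OnlinePolicy U B n) (i : Fin n) {C : Set (List U)}
    (hC : ∀ l ∈ C, l.Nodup) (s s' : U → Bool) (k : ℕ) (l : List U) (σ : OnlineState U B n)
    (h : ∀ x, x ∉ l → s x = s' x) : P.process i C s k l σ = P.process i C s' k l σ := by
  induction k generalizing l σ with
  | zero => rfl
  | succ k ih =>
    unfold OnlinePolicy.process
    split
    · rfl
    · rename_i x _
      split
      · rename_i hx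
        have hxl : x ∉ l := by
          have := hC _ hx
          rw [List.nodup_append] at this
          exact fun hx' => this.2.2 x hx' x (by simp) rfl
        rw [h x hxl]
        exact ih _ _ fun y hy => h y fun hy' => hy (List.mem_append_left _ hy')
      · rfl

/-- The view of the history agrees with the matching on which offline vertices are matched. -/
def ViewSound (σ : OnlineState U B n) : Prop :=
  ∀ x, x ∈ (OnlineView.ofHistory σ.history).sold ↔ ∃ j, (x, j) ∈ σ.matching

theorem ViewSound.arrive {σ : OnlineState U B n} (h : ViewSound σ) (i : Fin n) (b : B) :
    ViewSound (⟨σ.history ++ [.arrive i b], σ.matching⟩ : OnlineState U B n) := by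
  intro x
  simpa only [OnlineView.ofHistory_append, OnlineView.step] using h x

theorem ViewSound.probe {σ : OnlineState U B n} (h : ViewSound σ) (i : Fin n) (x : U) (t acc : Bool) :
    ViewSound (⟨σ.history ++ [.probe x t acc],
      if acc then insert (x, i) σ.matching else σ.matching⟩ : OnlineState U B n) := by
  intro y
  simp only [OnlineView.ofHistory_append, OnlineView.step, Set.mem_ofPred_eq, h y]
  cases acc
  · simp
  · simp only [true_and, if_true, Finset.mem_insert, Prod.mk.injEq, exists_or]
    rw [or_comm]
    simp

theorem ViewSound.process (P : OnlinePolicy U B n) (i : Fin n) (C : Set (List U)) (s : U → Bool)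
    (k : ℕ) (l : List U) {σ : OnlineState U B n} (h : ViewSound σ) :
    ViewSound (P.process i C s k l σ) := by
  induction k generalizing l σ with
  | zero => exact h
  | succ k ih =>
    unfold OnlinePolicy.process
    split
    · exact h
    · split
      · exact ih _ (h.probe i _ _ _)
      · exact h

/-- Keeps vertices that have not yet arrived unmatched, as the induction over arrivals requires. -/
theorem mem_of_mem_process (P : OnlinePolicy U B n) (i : Fin n) (C : Set (List U)) (s : U → Bool)
    (k : ℕ) (l : List U) (σ : OnlineState U B n) {x : U} {j : Fin n} (hj : j ≠ i)
    (h : (x, j) ∈ (P.process i C s k l σ).matching) : (x, j) ∈ σ.matching := by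
  induction k generalizing l σ with
  | zero => exact h
  | succ k ih =>
    unfold OnlinePolicy.process at h
    split at h
    · exact h
    · split at h
      · have := ih _ _ h
        dsimp only at this
        split at this
        · simpa [hj] using this
        · exact this
      · exact h

end OnlinePolicy

/-! ### The potential argument for the price policy -/

namespace KnownIDInput

open scoped Classical
open OnlinePolicy

variable {U : Type u} {B : Type v} {n : ℕ}

/-- A lower bound on what an unsold offline vertex contributes when the vertices in the list are still to
arrive, vertex `i` offering it an expected gain of `a i`. -/
noncomputable def unsoldBound (price : U → ℝ) (a : Fin n → U → ℝ) : List (Fin n) → U → ℝ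
  | [], _ => 0
  | i :: L, x => min (price x) (a i x + unsoldBound price a L x)

theorem unsoldBound_le {price : U → ℝ} (h0 : ∀ x, 0 ≤ price x) (a : Fin n → U → ℝ)
    (L : List (Fin n)) (x : U) : unsoldBound price a L x ≤ price x := by
  cases L with
  | nil => exact h0 x
  | cons i L => exact min_le_left _ _

/-- Capping at the price after every arrival loses no more than capping the total once, since the
increments are nonnegative. -/
theorem min_le_unsoldBound {price : U → ℝ} {a : Fin n → U → ℝ}
    (ha : ∀ i x, 0 ≤ a i x) (L : List (Fin n)) (x : U) :
    min (price x) (L.map fun i => a i x).sum ≤ unsoldBound price a L x := by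
  induction L with
  | nil => simp [unsoldBound]
  | cons i L ih =>
    simp only [unsoldBound, List.map_cons, List.sum_cons]
    refine le_min (min_le_left _ _) ?_
    have := ha i x
    rcases le_total (price x) (L.map fun i => a i x).sum with h | h
    · rw [min_eq_left h] at ih
      exact (min_le_left _ _).trans (by linarith)
    · rw [min_eq_right h] at ih
      exact (min_le_right _ _).trans (by linarith)

variable [Fintype U]

/-- The total of `c` over the offline vertices which `M` leaves unmatched. -/
noncomputable def unsoldValue (c : U → ℝ) (M : Finset (U × Fin n)) : ℝ :=
  ∑ x, if ∃ j, (x, j) ∈ M then 0 else c x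

theorem unsoldValue_insert (c : U → ℝ) {M : Finset (U × Fin n)} {x : U} (i : Fin n)
    (hx : ∀ j, (x, j) ∉ M) : unsoldValue c (insert (x, i) M) = unsoldValue c M - c x := by
  unfold unsoldValue
  rw [← Finset.add_sum_erase _ _ (Finset.mem_univ x),
    ← Finset.add_sum_erase _ (fun y => if ∃ j, (y, j) ∈ M then 0 else c y) (Finset.mem_univ x)]
  have : ∑ y ∈ Finset.univ.erase x, (if ∃ j, (y, j) ∈ insert (x, i) M then 0 else c y)
      = ∑ y ∈ Finset.univ.erase x, (if ∃ j, (y, j) ∈ M then 0 else c y) := by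
    refine Finset.sum_congr rfl fun y hy => ?_
    simp [Finset.ne_of_mem_erase hy]
  rw [this, if_pos ⟨i, Finset.mem_insert_self _ _⟩, if_neg (by simpa using hx)]
  ring

theorem pricePolicy_probe_of_matched (I : KnownIDInput U B n) (price : U → ℝ)
    {h : List (OnlineEvent U B n)} (hm : (OnlineView.ofHistory h).matched = true) :
    (I.pricePolicy price).probe h = none := by
  simp only [pricePolicy, hm, if_true]
  split <;> rfl

theorem process_pricePolicy_of_matched (I : KnownIDInput U B n) (price : U → ℝ) (i : Fin n)
    (C : Set (List U)) (s : U → Bool) (k : ℕ) (l : List U) (σ : OnlineState U B n)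
    (hm : (OnlineView.ofHistory σ.history).matched = true) :
    (I.pricePolicy price).process i C s k l σ = σ := by
  cases k with
  | zero => rfl
  | succ k => simp only [OnlinePolicy.process, I.pricePolicy_probe_of_matched price hm]

/-- The price policy gains the optimal value at every online vertex, if every offline vertex is worth at
most its price. -/
theorem le_prodExp_process (I : KnownIDInput U B n) {price c : U → ℝ} (hc : ∀ x, c x ≤ price x)
    (i : Fin n) (b : Fin n → B) (k : ℕ) :
    ∀ (l : List U) (σ : OnlineState U B n) (sold : Set U), k + l.length = Fintype.card U →
      OnlineView.ofHistory σ.history = ⟨some (b i), l, false, sold⟩ → ViewSound σ →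
      (∀ x, (x, i) ∉ σ.matching) →
      (I.draw b).setWeight σ.matching + unsoldValue c σ.matching + I.saleValue price sold (b i) k l
        ≤ prodExp (bern fun x => I.typeGraph.prob x (b i)) fun s =>
            (I.draw b).setWeight
              ((I.pricePolicy price).process i (I.typeGraph.probing (b i)) s k l σ).matching
            + unsoldValue c
              ((I.pricePolicy price).process i (I.typeGraph.probing (b i)) s k l σ).matching := by
  have hsum := sum_bern fun x => I.typeGraph.prob x (b i)
  induction k with
  | zero =>
    intro l σ sold _ _ _ _
    simp only [OnlinePolicy.process, prodExp_const hsum, saleValue, bestValue, add_zero, le_refl]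
  | succ k ih =>
    intro l σ sold hk hv hs hM
    -- The policy has no step counter: it recovers its remaining budget from the length of the
    -- probed string.
    have hk1 : Fintype.card U - l.length = k + 1 := by omega
    have hprobe : (I.pricePolicy price).probe σ.history
        = bestMove (fun x => I.typeGraph.prob x (b i)) (I.saleReward price sold (b i))
            (I.typeGraph.probing (b i)) (k + 1) l := by
      simp only [pricePolicy, hv, hk1]
      simp
    have hcommit : ∀ x, (I.pricePolicy price).commit σ.history x
        = decide (I.saleValue price sold (b i) k (l ++ [x]) < I.saleReward price sold (b i) x) := by
      intro x
      simp only [pricePolicy, hv, hk1, Nat.add_sub_cancel]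
    have hbest : I.saleValue price sold (b i) (k + 1) l = moveValue _ _ _ _ _ _ :=
      bestValue_succ _ _ _ _ _
    rw [← hprobe] at hbest
    rcases hP : (I.pricePolicy price).probe σ.history with _ | x
    · rw [hP] at hbest
      simp only [OnlinePolicy.process, hP, prodExp_const hsum, hbest, moveValue, add_zero, le_refl]
    rw [hP] at hbest
    by_cases hC : l ++ [x] ∈ I.typeGraph.probing (b i)
    swap
    · simp only [OnlinePolicy.process, hP, hC, if_false, prodExp_const hsum, hbest, moveValue,
        add_zero, le_refl]
    simp only [moveValue, hC, if_true] at hbest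
    change I.saleValue price sold (b i) (k + 1) l
      = I.typeGraph.prob x (b i) * max (I.saleReward price sold (b i) x)
          (I.saleValue price sold (b i) k (l ++ [x]))
        + (1 - I.typeGraph.prob x (b i)) * I.saleValue price sold (b i) k (l ++ [x]) at hbest
    let F : Bool → OnlineState U B n := fun t =>
      let acc : Bool := t && decide (EdgeFree σ.matching x i)
        && (I.pricePolicy price).commit σ.history x
      ⟨σ.history ++ [.probe x t acc], if acc then insert (x, i) σ.matching else σ.matching⟩
    let Ψ : Finset (U × Fin n) → ℝ := fun M => (I.draw b).setWeight M + unsoldValue c M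
    let R : Bool → (U → Bool) → ℝ := fun t s => Ψ
      ((I.pricePolicy price).process i (I.typeGraph.probing (b i)) s k (l ++ [x]) (F t)).matching
    have hR : ∀ t s t', R t (Function.update s x t') = R t s := by
      intro t s t'
      simp only [R]
      rw [OnlinePolicy.process_congr _ i (I.typeGraph.probing_nodup (b i)) _ s]
      intro y hy
      exact Function.update_of_ne (fun h => hy (by simp [h])) _ _
    have hcont : ∀ t, (t && decide (EdgeFree σ.matching x i)
        && (I.pricePolicy price).commit σ.history x) = false →
        Ψ σ.matching + I.saleValue price sold (b i) k (l ++ [x])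
          ≤ prodExp (bern fun x => I.typeGraph.prob x (b i)) (R t) := by
      intro t ht
      have hFt : F t = ⟨σ.history ++ [.probe x t false], σ.matching⟩ := by
        simp only [F, ht, Bool.false_eq_true, if_false]
      have := ih (l ++ [x]) (F t) sold (by simp; omega)
        (by rw [hFt, OnlineView.ofHistory_append, hv]; simp [OnlineView.step])
        (hs.probe i _ _ _) (by rw [hFt]; exact hM)
      rw [show (F t).matching = σ.matching by rw [hFt]] at this
      exact this
    have h0 := hcont false (by simp)
    have h1 : Ψ σ.matching + max (I.saleReward price sold (b i) x)
        (I.saleValue price sold (b i) k (l ++ [x]))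
        ≤ prodExp (bern fun x => I.typeGraph.prob x (b i)) (R true) := by
      by_cases hlt : I.saleValue price sold (b i) k (l ++ [x]) < I.saleReward price sold (b i) x
      -- Committing requires strictly beating a nonnegative continuation value, so `x` is unsold and
      -- its weight exceeds its price.
      · have hpos : 0 < I.saleReward price sold (b i) x :=
          (bestValue_nonneg _ _ _ _ _).trans_lt hlt
        have hx : x ∉ sold := fun hx => by simp [saleReward, hx] at hpos
        have hxM : ∀ j, (x, j) ∉ σ.matching := by
          have := hs x
          rw [hv] at this
          exact fun j hj => hx (this.2 ⟨j, hj⟩)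
        have hfree : EdgeFree σ.matching x i := by
          rintro ⟨y, j⟩ he
          exact ⟨fun h => hxM j (by subst h; exact he), fun h => hM y (by subst h; exact he)⟩
        have hFt : F true = ⟨σ.history ++ [.probe x true true], insert (x, i) σ.matching⟩ := by
          simp [F, hcommit, hlt, hfree]
        have hRt : ∀ s, R true s = Ψ (insert (x, i) σ.matching) := by
          intro s
          simp only [R]
          rw [I.process_pricePolicy_of_matched price]
          · rw [hFt]
          · rw [hFt, OnlineView.ofHistory_append]
            simp [OnlineView.step]
        have hrew : I.saleReward price sold (b i) x = I.typeGraph.weight x (b i) - price x := by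
          simp only [saleReward, hx, if_false] at hpos ⊢
          exact max_eq_left (le_of_lt ((lt_max_iff.1 hpos).resolve_right (lt_irrefl _)))
        simp only [show R true = fun _ => _ from funext hRt, prodExp_const hsum]
        rw [max_eq_left hlt.le, hrew]
        simp only [Ψ]
        -- The sale changes the potential by weight minus `c x`, which is at least weight minus
        -- price because `c x ≤ price x`.
        rw [unsoldValue_insert c i hxM, StochasticGraph.setWeight, StochasticGraph.setWeight,
          Finset.sum_insert (hxM i)]
        have : (I.draw b).weight x i = I.typeGraph.weight x (b i) := rfl
        dsimp only
        rw [this]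
        linarith [hc x]
      · rw [max_eq_right (not_lt.1 hlt)]
        exact hcont true (by simp [hcommit, hlt])
    have hsplit : (fun s : U → Bool => Ψ ((I.pricePolicy price).process i
          (I.typeGraph.probing (b i)) s k (l ++ [x]) (F (s x))).matching)
        = fun s => if s x then R true s else R false s := by
      funext s
      cases s x <;> simp [R]
    simp only [OnlinePolicy.process, hP, hC, if_true]
    change Ψ σ.matching + _ ≤ prodExp _ fun s : U → Bool => Ψ ((I.pricePolicy price).process i
          (I.typeGraph.probing (b i)) s k (l ++ [x]) (F (s x))).matching
    rw [hsplit, prodExp_bern_ite _ _ _ _ (hR true) (hR false), hbest]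
    have hp0 := I.typeGraph.prob_nonneg x (b i)
    have hp1 := I.typeGraph.prob_le_one x (b i)
    have e1 := mul_le_mul_of_nonneg_left h1 hp0
    have e0 := mul_le_mul_of_nonneg_left h0 (sub_nonneg.2 hp1)
    linarith

/-- The state after the arrival of the online vertices in the list `L`, `η` giving their types and edge
states. -/
noncomputable def arrivals (I : KnownIDInput U B n) (P : OnlinePolicy U B n)
    (η : Fin n → B × (U → Bool)) (L : List (Fin n)) (σ : OnlineState U B n) : OnlineState U B n :=
  L.foldl (fun σ i => P.process i (I.typeGraph.probing (η i).1) (η i).2 (Fintype.card U) []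
      ⟨σ.history ++ [.arrive i (η i).1], σ.matching⟩) σ

theorem arrivals_congr (I : KnownIDInput U B n) (P : OnlinePolicy U B n)
    {η η' : Fin n → B × (U → Bool)} {L : List (Fin n)} (h : ∀ i ∈ L, η i = η' i)
    (σ : OnlineState U B n) : I.arrivals P η L σ = I.arrivals P η' L σ :=
  List.foldl_ext _ _ _ fun σ i hi => by rw [h i hi]

/-- The potential is a submartingale. The state `σ` is arbitrary, and `b` records the types of the
vertices outside `L`, on which the weight of the present matching depends. Resampling coordinate `i`
isolates one arrival: `le_prodExp_process` handles it, and the induction hypothesis handles the rest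
for each outcome. -/
theorem le_prodExp_arrivals [Fintype B] (I : KnownIDInput U B n) {price : U → ℝ} (h0 : ∀ x, 0 ≤ price x)
    {a : Fin n → U → ℝ}
    (ha : ∀ (i : Fin n) (sold : Set U), ∑ x, (if x ∈ sold then 0 else a i x)
      ≤ ∑ b, (I.dist i b).toReal * I.saleValue price sold b (Fintype.card U) [])
    (L : List (Fin n)) :
    ∀ (σ : OnlineState U B n) (b : Fin n → B), L.Nodup → ViewSound σ →
      (∀ i ∈ L, ∀ x, (x, i) ∉ σ.matching) →
      (I.draw b).setWeight σ.matching + unsoldValue (unsoldBound price a L) σ.matching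
        ≤ prodExp I.law fun η => (I.draw fun i => if i ∈ L then (η i).1 else b i).setWeight
            (I.arrivals (I.pricePolicy price) η L σ).matching := by
  induction L with
  | nil =>
    intro σ b _ _ _
    simp [arrivals, prodExp_const I.sum_law, unsoldValue, unsoldBound]
  | cons i L ih =>
    intro σ b hL hs hM
    obtain ⟨hiL, hL⟩ := List.nodup_cons.1 hL
    set c := unsoldBound price a L with hcdef
    let P := I.pricePolicy price
    let σ' : B → (U → Bool) → OnlineState U B n := fun t s =>
      P.process i (I.typeGraph.probing t) s (Fintype.card U) []
        ⟨σ.history ++ [.arrive i t], σ.matching⟩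
    have hs' : ∀ t s, ViewSound (σ' t s) := fun t s => (hs.arrive i t).process _ _ _ _ _ _
    have hM' : ∀ t s, ∀ j ∈ L, ∀ x, (x, j) ∉ (σ' t s).matching := by
      intro t s j hj x hx
      have hji : j ≠ i := fun h => hiL (h ▸ hj)
      exact hM j (List.mem_cons_of_mem _ hj) x (P.mem_of_mem_process i _ s _ _ ⟨σ.history ++ [.arrive i t], σ.matching⟩ hji hx)
    rw [prodExp_resample i (I.sum_law i)]
    have hstep : ∀ (t : B) (s : U → Bool),
        (I.draw (Function.update b i t)).setWeight (σ' t s).matching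
            + unsoldValue c (σ' t s).matching
          ≤ prodExp I.law fun η => (I.draw fun j => if j ∈ i :: L then
              (Function.update η i (t, s) j).1 else b j).setWeight
              (I.arrivals P (Function.update η i (t, s)) (i :: L) σ).matching := by
      intro t s
      refine (ih (σ' t s) (Function.update b i t) hL (hs' t s) (hM' t s)).trans_eq ?_
      congr 1
      funext η
      have e1 : I.arrivals P (Function.update η i (t, s)) (i :: L) σ
          = I.arrivals P η L (σ' t s) := by
        have : I.arrivals P (Function.update η i (t, s)) (i :: L) σ
            = I.arrivals P (Function.update η i (t, s)) L (σ' t s) := by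
          simp [arrivals, σ']
        rw [this]
        exact I.arrivals_congr P (fun j hj => Function.update_of_ne (fun h : j = i => hiL (h ▸ hj)) _ _) _
      rw [e1]
      congr 2
      funext j
      by_cases hj : j = i
      · subst hj
        simp [hiL]
      · simp [hj]
    refine le_trans ?_ (Finset.sum_le_sum fun q _ =>
      mul_le_mul_of_nonneg_left (hstep q.1 q.2) (I.law_nonneg i q))
    rw [I.sum_law_mul i fun t s => (I.draw (Function.update b i t)).setWeight (σ' t s).matching
            + unsoldValue c (σ' t s).matching]
    set sold := (OnlineView.ofHistory σ.history).sold with hsold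
    have hvertex : ∀ t, (I.draw b).setWeight σ.matching + unsoldValue c σ.matching
          + I.saleValue price sold t (Fintype.card U) []
        ≤ prodExp (bern fun x => I.typeGraph.prob x t) fun s =>
            (I.draw (Function.update b i t)).setWeight (σ' t s).matching
              + unsoldValue c (σ' t s).matching := by
      intro t
      have := I.le_prodExp_process (c := c) (unsoldBound_le h0 a L) i (Function.update b i t)
        (Fintype.card U) [] ⟨σ.history ++ [.arrive i t], σ.matching⟩ sold (by simp)
        (by rw [OnlineView.ofHistory_append]; simp [OnlineView.step, hsold])
        (hs.arrive i t) (hM i List.mem_cons_self)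
      rw [Function.update_self] at this
      refine le_trans (le_of_eq ?_) this
      congr 2
      -- Vertex `i` is unmatched before its arrival, so revealing its type does not alter the weight
      -- already collected.
      refine Finset.sum_congr rfl fun e he => ?_
      have : e.2 ≠ i := fun h => hM i List.mem_cons_self e.1 (by rw [← h]; exact he)
      simp [draw, this]
    refine le_trans ?_ (Finset.sum_le_sum fun t _ =>
      mul_le_mul_of_nonneg_left (hvertex t) ENNReal.toReal_nonneg)
    simp only [mul_add, Finset.sum_add_distrib, ← Finset.sum_mul, sum_toReal_pmf, one_mul]
    -- The second term of the minimum defining `unsoldBound` says that the drop of the potential is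
    -- covered by the gains `a i x` of unsold vertices.
    have hcs : unsoldValue (unsoldBound price a (i :: L)) σ.matching
        ≤ unsoldValue c σ.matching + ∑ x, (if x ∈ sold then 0 else a i x) := by
      unfold unsoldValue
      rw [← Finset.sum_add_distrib]
      refine Finset.sum_le_sum fun x _ => ?_
      have hx := hs x
      rw [← hsold] at hx
      by_cases h : x ∈ sold
      · simp [h, hx.1 h]
      · rw [if_neg h, if_neg (fun h' => h (hx.2 h')), if_neg (fun h' => h (hx.2 h'))]
        exact (min_le_right _ _).trans (by rw [hcdef, add_comm])
    linarith [ha i sold]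

end KnownIDInput

/-! ### The price policy is `1/2`-competitive -/

namespace KnownIDInput

open scoped Classical
open OnlinePolicy

variable {U : Type u} {B : Type v} [Fintype U] {n : ℕ}

/-- The matching of an optimal offline probing algorithm on the drawn graph. -/
noncomputable def optMatching (I : KnownIDInput U B n) (η : Fin n → B × (U → Bool)) :
    Finset (U × Fin n) :=
  (I.draw fun i => (η i).1).optPolicy.run (I.draw fun i => (η i).1) fun x i => (η i).2 x

theorem isEdgeMatching_optMatching (I : KnownIDInput U B n) (η : Fin n → B × (U → Bool)) :
    IsEdgeMatching (I.optMatching η) :=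
  OfflinePolicy.isEdgeMatching_exec _ _ _ _ _ (by simp [IsEdgeMatching])

theorem sum_ite_mem_optMatching_le (I : KnownIDInput U B n) (η : Fin n → B × (U → Bool)) (x : U)
    {c : ℝ} (hc : 0 ≤ c) : ∑ i, (if (x, i) ∈ I.optMatching η then c else 0) ≤ c := by
  by_cases h : ∃ j, (x, j) ∈ I.optMatching η
  · obtain ⟨j, hj⟩ := h
    rw [Finset.sum_eq_single j]
    · rw [if_pos hj]
    · intro i _ hij
      rw [if_neg]
      intro hi
      exact hij (congrArg Prod.snd (I.isEdgeMatching_optMatching η _ hi _ hj (Or.inl rfl)))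
    · simp
  · push Not at h
    simpa [h] using hc

variable [Fintype B]

/-- Half of the expected weight which the benchmark obtains from `x`. -/
noncomputable def benchmarkPrice (I : KnownIDInput U B n) (x : U) : ℝ :=
  1 / 2 * prodExp I.law fun η =>
    ∑ i, if (x, i) ∈ I.optMatching η then max (I.typeGraph.weight x (η i).1) 0 else 0

/-- The expected gain over the benchmark price which the benchmark obtains from the edge `(x, i)`. -/
noncomputable def benchmarkGain (I : KnownIDInput U B n) (i : Fin n) (x : U) : ℝ :=
  prodExp I.law fun η =>
    if (x, i) ∈ I.optMatching η then max (I.typeGraph.weight x (η i).1 - I.benchmarkPrice x) 0 else 0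

theorem benchmarkPrice_nonneg (I : KnownIDInput U B n) (x : U) : 0 ≤ I.benchmarkPrice x :=
  mul_nonneg (by norm_num) (prodExp_nonneg I.law_nonneg fun η => Finset.sum_nonneg fun i _ => by
    split
    · exact le_max_right _ _
    · exact le_rfl)

theorem benchmarkGain_nonneg (I : KnownIDInput U B n) (i : Fin n) (x : U) :
    0 ≤ I.benchmarkGain i x :=
  prodExp_nonneg I.law_nonneg fun η => by
    split
    · exact le_max_right _ _
    · exact le_rfl

/-- The benchmark collects `2 * p` at `x` in expectation and matches `x` at most once, so
subtracting the price costs at most `p`. The factor `1 / 2` in the price balances these two halves.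
-/
theorem benchmarkPrice_le_sum_benchmarkGain (I : KnownIDInput U B n) (x : U) :
    I.benchmarkPrice x ≤ ∑ i, I.benchmarkGain i x := by
  have h2 : prodExp I.law (fun η =>
      ∑ i, if (x, i) ∈ I.optMatching η then max (I.typeGraph.weight x (η i).1) 0 else 0)
      = 2 * I.benchmarkPrice x := by
    unfold benchmarkPrice; ring
  have hp := I.benchmarkPrice_nonneg x
  have h : prodExp I.law (fun η =>
      ∑ i, if (x, i) ∈ I.optMatching η then max (I.typeGraph.weight x (η i).1) 0 else 0)
      ≤ prodExp I.law fun η => (∑ i, if (x, i) ∈ I.optMatching η then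
          max (I.typeGraph.weight x (η i).1 - I.benchmarkPrice x) 0 else 0) + I.benchmarkPrice x := by
    refine prodExp_mono I.law_nonneg fun η => ?_
    refine le_trans ?_ (add_le_add_right (I.sum_ite_mem_optMatching_le η x hp) _)
    rw [← Finset.sum_add_distrib]
    refine Finset.sum_le_sum fun i _ => ?_
    split
    · refine max_le ?_ (add_nonneg (le_max_right _ _) hp)
      linarith [le_max_left (I.typeGraph.weight x (η i).1 - I.benchmarkPrice x) 0]
    · simp
  rw [h2, prodExp_add, prodExp_const I.sum_law, prodExp_sum] at h
  unfold benchmarkGain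
  linarith

theorem opt_le_sum_benchmarkPrice (I : KnownIDInput U B n) :
    I.opt ≤ 2 * ∑ x, I.benchmarkPrice x := by
  have h1 : I.opt ≤ ∑ b, I.typeProb b
      * (I.draw b).expectedWeight ((I.draw b).optPolicy.run (I.draw b)) :=
    Finset.sum_le_sum fun b _ => mul_le_mul_of_nonneg_left (I.draw b).opt_le_optPolicy
      (Finset.prod_nonneg fun i _ => ENNReal.toReal_nonneg)
  rw [I.sum_typeProb_mul fun b => (I.draw b).optPolicy.run (I.draw b)] at h1
  refine h1.trans ?_
  have h2 : 2 * ∑ x, I.benchmarkPrice x = prodExp I.law fun η => ∑ x, ∑ i,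
      if (x, i) ∈ I.optMatching η then max (I.typeGraph.weight x (η i).1) 0 else 0 := by
    rw [prodExp_sum, Finset.mul_sum]
    refine Finset.sum_congr rfl fun x _ => ?_
    unfold benchmarkPrice; ring
  rw [h2]
  refine prodExp_mono I.law_nonneg fun η => ?_
  rw [← Fintype.sum_prod_type' (f := fun x i => if (x, i) ∈ I.optMatching η then
    max (I.typeGraph.weight x (η i).1) 0 else 0), ← Finset.sum_filter, Finset.filter_univ_mem]
  exact Finset.sum_le_sum fun e _ => le_max_left _ _

/-- With the other coordinates and the type of `i` fixed, the optimal offline algorithm is one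
particular way of probing `i`, hence no better than the best one. As `sold` is fixed in advance,
resampling vertex `i` leaves the rewards for a given type unchanged. -/
theorem sum_benchmarkGain_le (I : KnownIDInput U B n) (i : Fin n) (sold : Set U) :
    ∑ x, (if x ∈ sold then 0 else I.benchmarkGain i x)
      ≤ ∑ b, (I.dist i b).toReal * I.saleValue I.benchmarkPrice sold b (Fintype.card U) [] := by
  have h1 : ∑ x, (if x ∈ sold then 0 else I.benchmarkGain i x)
      = prodExp I.law fun η =>
          rewardAt (I.saleReward I.benchmarkPrice sold (η i).1) i (I.optMatching η) := by
    simp only [rewardAt]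
    rw [prodExp_sum]
    refine Finset.sum_congr rfl fun x _ => ?_
    by_cases hx : x ∈ sold
    · simp [saleReward, hx, prodExp]
    · simp only [saleReward, hx, if_false, benchmarkGain]
      congr!
  rw [h1, prodExp_resample i (I.sum_law i)]
  simp only [Function.update_self, ← prodExp_const_mul]
  rw [← prodExp_sum]
  -- The right-hand side does not depend on the other coordinates, so it suffices to bound the
  -- conditional expectation for each fixed `η`.
  refine le_trans (prodExp_mono I.law_nonneg fun η => ?_) (prodExp_const I.sum_law _).le
  rw [I.sum_law_mul i fun t s => rewardAt (I.saleReward I.benchmarkPrice sold t) i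
    (I.optMatching (Function.update η i (t, s)))]
  refine Finset.sum_le_sum fun t _ => mul_le_mul_of_nonneg_left ?_ ENNReal.toReal_nonneg
  set b' : Fin n → B := Function.update (fun j => (η j).1) i t with hb'
  have htypes : ∀ s, (fun j => (Function.update η i (t, s) j).1) = b' := by
    intro s
    funext j
    by_cases hj : j = i
    · subst hj; simp [hb']
    · simp [hb', hj]
  have hstates : ∀ s, (fun x j => (Function.update η i (t, s) j).2 x)
      = setColumn (fun x j => (η j).2 x) i s := by
    intro s
    funext x j
    by_cases hj : j = i
    · subst hj; simp [setColumn]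
    · simp [setColumn, hj]
  have hi : b' i = t := by simp [hb']
  have key := (I.draw b').optPolicy.rewardAt_exec_le (I.draw b') (fun x j => (η j).2 x) i
    (I.saleReward I.benchmarkPrice sold t) (Fintype.card U * Fintype.card (Fin n)) ⟨[], ∅⟩
    (Fintype.card U) (by simp [OfflineState.probed]) (by simp)
  have e1 : (fun x => (I.draw b').prob x i) = fun x => I.typeGraph.prob x t := by
    simp only [draw, hi]
  have e2 : (I.draw b').probing i = I.typeGraph.probing t := by
    simp only [draw, hi]
  rw [e1, e2] at key
  simp only [optMatching, htypes, hstates]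
  exact key

theorem half_opt_le_onlineValue (I : KnownIDInput U B n) (π : Equiv.Perm (Fin n)) :
    1 / 2 * I.opt ≤ I.onlineValue (PMF.pure (I.pricePolicy I.benchmarkPrice)) π := by
  rw [onlineValue, seedAverage_pure,
    I.sum_typeProb_mul fun b => (I.pricePolicy I.benchmarkPrice).run I π b]
  -- An arbitrary type vector: every vertex occurs in the arrival list, so `b` is overwritten
  -- throughout.
  choose b _ using fun i => (I.dist i).support_nonempty
  have h := I.le_prodExp_arrivals I.benchmarkPrice_nonneg I.sum_benchmarkGain_le (List.ofFn π)
    ⟨[], ∅⟩ b (List.nodup_ofFn.2 π.injective) (by simp [ViewSound, OnlineView.ofHistory]) (by simp)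
  have hmem : ∀ i, i ∈ List.ofFn π := fun i => (List.mem_ofFn' _ _).2 ⟨π.symm i, by simp⟩
  simp only [hmem, if_true] at h
  refine le_trans ?_ h
  have hL : ∀ x, I.benchmarkPrice x
      ≤ unsoldBound I.benchmarkPrice I.benchmarkGain (List.ofFn π) x := by
    intro x
    refine le_trans (le_min le_rfl ?_) (min_le_unsoldBound I.benchmarkGain_nonneg _ x)
    rw [List.map_ofFn, List.sum_ofFn]
    refine (I.benchmarkPrice_le_sum_benchmarkGain x).trans_eq ?_
    exact (Equiv.sum_comp π fun i => I.benchmarkGain i x).symm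
  have : ∑ x, I.benchmarkPrice x
      ≤ unsoldValue (unsoldBound I.benchmarkPrice I.benchmarkGain (List.ofFn π))
        (∅ : Finset (U × Fin n)) := by
    simpa [unsoldValue] using Finset.sum_le_sum fun x (_ : x ∈ Finset.univ) => hL x
  have h0 : (I.draw b).setWeight ∅ = 0 := by simp [StochasticGraph.setWeight]
  linarith [I.opt_le_sum_benchmarkPrice]

end KnownIDInput

/-! ### Optimality of the ratio `1/2` -/

namespace KnownIDInput

variable {U : Type u} {B : Type v} {n : ℕ}

theorem typeProb_of_dist_eq_pure (I : KnownIDInput U B n) {b₀ : Fin n → B}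
    (h : ∀ i, I.dist i = PMF.pure (b₀ i)) [DecidableEq (Fin n → B)] (b : Fin n → B) :
    I.typeProb b = if b = b₀ then 1 else 0 := by
  classical
  have : ∀ i, (I.dist i (b i)).toReal = if b i = b₀ i then 1 else 0 := by
    intro i
    rw [h, PMF.pure_apply]
    split <;> simp
  simp only [typeProb, this, Finset.prod_boole, funext_iff, Finset.mem_univ, true_imp_iff]

open Classical in
theorem opt_of_dist_eq_pure [Fintype U] [Fintype B] (I : KnownIDInput U B n) {b₀ : Fin n → B}
    (h : ∀ i, I.dist i = PMF.pure (b₀ i)) : I.opt = (I.draw b₀).opt := by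
  simp [opt, I.typeProb_of_dist_eq_pure h]

open Classical in
theorem onlineValue_of_dist_eq_pure [Fintype U] [Fintype B] (I : KnownIDInput U B n)
    {b₀ : Fin n → B} (h : ∀ i, I.dist i = PMF.pure (b₀ i)) (A : PMF (OnlinePolicy U B n))
    (π : Equiv.Perm (Fin n)) : I.onlineValue A π
      = seedAverage A fun P => (I.draw b₀).expectedWeight (P.run I π b₀) := by
  simp [onlineValue, I.typeProb_of_dist_eq_pure h]

end KnownIDInput

/-- Two types of edges: one of weight `1` which is active, and one of weight `1 / ε` which is active with
probability `ε`. -/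
noncomputable def hardTypeGraph {ε : ℝ} (h0 : 0 ≤ ε) (h1 : ε ≤ 1) :
    StochasticGraph PUnit.{u + 1} (ULift.{v} Bool) where
  weight _ b := if b.down then ε⁻¹ else 1
  prob _ b := if b.down then ε else 1
  prob_nonneg _ b := by split <;> linarith
  prob_le_one _ b := by split <;> linarith
  probing _ := {l | l.Nodup}
  probing_nodup _ _ h := h
  probing_nil _ := List.nodup_nil
  probing_infix _ _ h _ h' := h.sublist h'.sublist
  probing_perm _ _ h _ h' := h'.nodup_iff.2 h

/-- The types of the two online vertices of the hard input. -/
def hardTypes (i : Fin 2) : ULift.{v} Bool := ⟨decide (i = 1)⟩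

/-- The edge which is surely active comes first, the valuable one second. -/
noncomputable def hardInput {ε : ℝ} (h0 : 0 ≤ ε) (h1 : ε ≤ 1) :
    KnownIDInput PUnit.{u + 1} (ULift.{v} Bool) 2 where
  typeGraph := hardTypeGraph h0 h1
  dist i := PMF.pure (hardTypes i)

section hardInput

open scoped Classical

variable {ε : ℝ} (h0 : 0 ≤ ε) (h1 : ε ≤ 1)

theorem expectedWeight_hardInput
    (f : (PUnit.{u + 1} → Fin 2 → Bool) → Finset (PUnit.{u + 1} × Fin 2)) :
    ((hardInput.{u, v} h0 h1).draw hardTypes).expectedWeight f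
      = (1 - ε) * ((hardInput.{u, v} h0 h1).draw hardTypes).setWeight (f fun _ => ![true, false])
        + ε * ((hardInput.{u, v} h0 h1).draw hardTypes).setWeight (f fun _ => ![true, true]) := by
  set G := (hardInput.{u, v} h0 h1).draw hardTypes with hG
  have hE : G.expectedWeight f
      = ∑ st : PUnit.{u + 1} → Fin 2 → Bool, G.stateProb st * G.setWeight (f st) := by
    unfold StochasticGraph.expectedWeight
    congr!
  let e : Bool × Bool ≃ (PUnit.{u + 1} → Fin 2 → Bool) :=
    { toFun := fun q _ => ![q.1, q.2]
      invFun := fun st => (st ⟨⟩ 0, st ⟨⟩ 1)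
      left_inv := fun _ => rfl
      right_inv := fun st => by
        funext x i
        fin_cases i <;> rfl }
  rw [hE, ← Equiv.sum_comp e, Fintype.sum_prod_type]
  have hp0 : G.prob ⟨⟩ 0 = 1 := by
    simp [hG, KnownIDInput.draw, hardInput, hardTypeGraph, hardTypes]
  have hp1 : G.prob ⟨⟩ 1 = ε := by
    simp [hG, KnownIDInput.draw, hardInput, hardTypeGraph, hardTypes]
  have hst : ∀ q, G.stateProb (e q) = (if q.1 then 1 else 0) * (if q.2 then ε else 1 - ε) := by
    intro q
    have he : ∀ x i, e q x i = ![q.1, q.2] i := fun _ _ => rfl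
    simp only [StochasticGraph.stateProb, Finset.univ_unique, Finset.prod_singleton,
      Fin.prod_univ_two, he]
    simp [hp0, hp1]
  simp only [hst, Fintype.sum_bool, Bool.false_eq_true, if_true, if_false, zero_mul, add_zero,
    one_mul]
  exact add_comm _ _

theorem setWeight_hardInput_nonneg (M : Finset (PUnit.{u + 1} × Fin 2)) :
    0 ≤ ((hardInput.{u, v} h0 h1).draw hardTypes).setWeight M := by
  refine Finset.sum_nonneg fun e _ => ?_
  simp only [KnownIDInput.draw, hardInput, hardTypeGraph]
  split
  · exact inv_nonneg.2 h0
  · exact zero_le_one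

/-- With a single offline vertex, handling an arrival is one yes-or-no decision, which reduces the
hard input to two such decisions. -/
theorem OnlinePolicy.process_one_matching {B : Type v} {n : ℕ}
    (P : OnlinePolicy PUnit.{u + 1} B n) (i : Fin n) (s : PUnit.{u + 1} → Bool)
    (σ : OnlineState PUnit.{u + 1} B n) :
    (P.process i {l | l.Nodup} s 1 [] σ).matching
      = if P.probe σ.history = some ⟨⟩ ∧ s ⟨⟩ = true ∧ EdgeFree σ.matching ⟨⟩ i
          ∧ P.commit σ.history ⟨⟩ = true
        then insert (⟨⟩, i) σ.matching else σ.matching := by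
  rcases hP : P.probe σ.history with _ | x
  · simp [OnlinePolicy.process, hP]
  · cases x
    simp only [OnlinePolicy.process, hP]
    simp only [List.nil_append, Set.mem_ofPred_eq, List.nodup_singleton, if_true, true_and,
      Bool.and_eq_true, decide_eq_true_eq, and_assoc]
    congr!

/-- Nothing is gained by waiting for the second edge. -/
theorem expectedWeight_run_hardInput_le (hε : 0 < ε)
    (P : OnlinePolicy PUnit.{u + 1} (ULift.{v} Bool) 2) :
    ((hardInput.{u, v} h0 h1).draw hardTypes).expectedWeight
      (P.run (hardInput h0 h1) 1 hardTypes) ≤ 1 := by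
  set G := (hardInput.{u, v} h0 h1).draw hardTypes with hG
  let σ₀ : OnlineState PUnit.{u + 1} (ULift.{v} Bool) 2 := ⟨[.arrive 0 (hardTypes 0)], ∅⟩
  let σ₁ := P.process 0 {l | l.Nodup} (fun _ => true) 1 [] σ₀
  have hrun : ∀ t, P.run (hardInput.{u, v} h0 h1) 1 hardTypes (fun _ => ![true, t])
      = (P.process 1 {l | l.Nodup} (fun _ => t) 1 []
          ⟨σ₁.history ++ [.arrive 1 (hardTypes 1)], σ₁.matching⟩).matching := by
    intro t
    simp [OnlinePolicy.run, List.ofFn_succ, hardInput, hardTypeGraph, σ₁, σ₀]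
  have hw0 : G.weight ⟨⟩ 0 = 1 := by
    simp [hG, KnownIDInput.draw, hardInput, hardTypeGraph, hardTypes]
  have hw1 : G.weight ⟨⟩ 1 = ε⁻¹ := by
    simp [hG, KnownIDInput.draw, hardInput, hardTypeGraph, hardTypes]
  have hσ₁ : σ₁.matching = {(⟨⟩, 0)} ∨ σ₁.matching = ∅ := by
    simp only [σ₁, OnlinePolicy.process_one_matching]
    split
    · left; simp [σ₀]
    · right; rfl
  rw [hG, expectedWeight_hardInput, ← hG, hrun, hrun]
  simp only [OnlinePolicy.process_one_matching]
  -- Either the sure edge was taken, blocking the second and giving exactly `1`, or only the second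
  -- can be won, giving at most `ε * ε⁻¹ = 1`.
  rcases hσ₁ with h | h
  · have : ¬ EdgeFree ({(⟨⟩, 0)} : Finset (PUnit.{u + 1} × Fin 2)) ⟨⟩ 1 := by
      simp [EdgeFree]
    rw [h]
    simp [this, StochasticGraph.setWeight, hw0]
  · rw [h]
    simp only [Bool.false_eq_true, false_and, and_false, if_false]
    split
    · simp [StochasticGraph.setWeight, hw1, hε.ne']
    · simp [StochasticGraph.setWeight]

theorem le_opt_hardInput (hε : 0 < ε) : 2 - ε ≤ (hardInput.{u, v} h0 h1).opt := by
  rw [KnownIDInput.opt_of_dist_eq_pure _ fun _ => rfl]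
  -- The risky edge is probed first; the sure edge remains as a fallback if it is inactive.
  let P : OfflinePolicy PUnit.{u + 1} (Fin 2) :=
    ⟨fun h => if h.length = 0 then some (⟨⟩, 1) else some (⟨⟩, 0), fun _ _ => true⟩
  refine le_trans ?_ (StochasticGraph.expectedWeight_le_opt _ P)
  set G := (hardInput.{u, v} h0 h1).draw hardTypes with hG
  have hC : ∀ i, G.probing i = {l | l.Nodup} := fun _ => rfl
  have hw0 : G.weight ⟨⟩ 0 = 1 := by
    simp [hG, KnownIDInput.draw, hardInput, hardTypeGraph, hardTypes]
  have hw1 : G.weight ⟨⟩ 1 = ε⁻¹ := by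
    simp [hG, KnownIDInput.draw, hardInput, hardTypeGraph, hardTypes]
  have hf : P.run G (fun _ => ![true, false]) = {(⟨⟩, 0)} := by
    simp [OfflinePolicy.run, OfflinePolicy.exec, P, OfflineState.probed, hC, EdgeFree]
  have ht : P.run G (fun _ => ![true, true]) = {(⟨⟩, 1)} := by
    simp [OfflinePolicy.run, OfflinePolicy.exec, P, OfflineState.probed, hC, EdgeFree]
  rw [hG, expectedWeight_hardInput, ← hG, hf, ht]
  simp only [StochasticGraph.setWeight, Finset.sum_singleton, hw0, hw1]
  rw [mul_inv_cancel₀ hε.ne']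
  linarith

theorem onlineValue_hardInput_le (hε : 0 < ε)
    (A : PMF (OnlinePolicy PUnit.{u + 1} (ULift.{v} Bool) 2)) :
    (hardInput.{u, v} h0 h1).onlineValue A 1 ≤ 1 := by
  rw [KnownIDInput.onlineValue_of_dist_eq_pure _ fun _ => rfl]
  have hle := expectedWeight_run_hardInput_le.{u, v} h0 h1 hε
  refine seedAverage_le A hle (d := 1) fun P => abs_le.2 ⟨?_, hle P⟩
  rw [expectedWeight_hardInput]
  have := mul_nonneg (sub_nonneg.2 h1) (setWeight_hardInput_nonneg.{u, v} h0 h1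
    (P.run (hardInput h0 h1) 1 hardTypes fun _ => ![true, false]))
  have := mul_nonneg h0 (setWeight_hardInput_nonneg.{u, v} h0 h1
    (P.run (hardInput h0 h1) 1 hardTypes fun _ => ![true, true]))
  linarith

end hardInput

theorem mainTheorem3 :
    (∃ A : OnlineProbingAlgorithm.{u, v}, A.IsCompetitive (1 / 2)) ∧
    (∀ α : ℝ, 1 / 2 < α →
      ∃ (U : Type u) (B : Type v) (_ : Fintype U) (_ : Fintype B) (n : ℕ) (I : KnownIDInput U B n)
        (π : Equiv.Perm (Fin n)),
        ∀ A : PMF (OnlinePolicy U B n), I.onlineValue A π < α * I.opt) := by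
  refine ⟨⟨fun U B _ _ n I => PMF.pure (I.pricePolicy I.benchmarkPrice),
    fun U B _ _ n I π => I.half_opt_le_onlineValue π⟩, fun α hα => ?_⟩
  have hα0 : 0 < α := by linarith
  have hinv : (2 * α)⁻¹ < 1 := inv_lt_one_of_one_lt₀ (by linarith)
  have hinv0 : 0 < (2 * α)⁻¹ := by positivity
  -- With `ε = 1 - (2 * α)⁻¹` one gets `α * (2 - ε) = α + 1 / 2 > 1`.
  have hε : 0 < 1 - (2 * α)⁻¹ := by linarith
  have h1 : 1 - (2 * α)⁻¹ ≤ 1 := by linarith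
  refine ⟨PUnit, ULift Bool, inferInstance, inferInstance, 2, hardInput hε.le h1, 1, fun A => ?_⟩
  refine (onlineValue_hardInput_le hε.le h1 hε A).trans_lt ?_
  refine lt_of_lt_of_le ?_ (mul_le_mul_of_nonneg_left (le_opt_hardInput hε.le h1 hε) hα0.le)
  have : α * (2 * α)⁻¹ = 1 / 2 := by field_simp
  nlinarith
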